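/- An algebraic number is \emph{totally real} if all complex roots of its minimal polynomial over $\mathbb{Q}$ are real. The \emph{height} of a finite rooted tree is the largest distance (number of edges) of a vertex from the root, and the eigenvalues of a graph are those of its adjacency matrix. The \emph{arboreal height} of a totally real algebraic integer $\lambda$ is the least $h$ such that $\lambda$ is an eigenvalue of some finite rooted tree of height $h$. Let $\lambda$ be a totally real algebraic integer with $[\mathbb{Q}(\lambda^2):\mathbb{Q}]=3$. Let $F\in\mathbb{Z}[x]$ be the (monic) minimal polynomial of $\lambda^2$, and let $\mu_1<\mu_2<\mu_3$ be its roots, which are positive real numbers. A set $\{k_1<k_2<k_3\}$ of nonnegative integers is called an \emph{interlacing set} for $\lambda^2$ if it is left-interlacing, that is, $k_1<\mu_1<k_2<\mu_2<k_3<\mu_3$, or right-interlacing, that is, $\mu_1<k_1<\mu_2<k_2<\mu_3<k_3$. Then $\lambda$ has arboreal height $2$ if and only if both of the following hold: there is an interlacing set for $\lambda^2$, and $F$ has a root modulo $2$. -/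

import Mathlib

/-- An algebraic number is totally real if all complex roots of its minimal polynomial
over `ℚ` are real. -/
def IsTotallyRealNumber (x : ℝ) : Prop :=
  IsAlgebraic ℚ x ∧ ∀ z : ℂ, Polynomial.aeval z (minpoly ℚ x) = 0 → z.im = 0

open Classical in
/-- `x` is an eigenvalue of (the adjacency matrix of) the finite graph `G`. -/
def IsGraphEigenvalue {V : Type} [Fintype V] (G : SimpleGraph V) (x : ℝ) : Prop :=
  Module.End.HasEigenvalue (Matrix.toLin' (G.adjMatrix ℝ)) x

/-- `x` is an eigenvalue of some finite rooted tree `(T, r)` of height `h`, the height being the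
largest distance (number of edges) of a vertex from the root `r`. -/
def IsEigenvalueOfRootedTreeOfHeight (x : ℝ) (h : ℕ) : Prop :=
  ∃ (V : Type) (_ : Fintype V) (T : SimpleGraph V) (r : V),
    T.IsTree ∧ T.eccent r = (h : ℕ∞) ∧ IsGraphEigenvalue T x

/-- `x` has arboreal height `h`: `h` is the least height of a rooted tree
that has `x` as an eigenvalue. -/
def HasArborealHeight (x : ℝ) (h : ℕ) : Prop :=
  IsLeast {h : ℕ | IsEigenvalueOfRootedTreeOfHeight x h} h

/-- `μ` lists the conjugates of `x` in increasing order, `n` being the degree of `x`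
(so all conjugates are real). -/
def IsIncreasingListOfConjugates (x : ℝ) (μ : Fin (minpoly ℚ x).natDegree → ℝ) : Prop :=
  StrictMono μ ∧ Set.range μ = (minpoly ℚ x).rootSet ℝ

/-- `K = {k₁ < ⋯ < kₙ}` with `k₁ < μ₁ < k₂ < μ₂ < ⋯ < kₙ < μₙ`, where `μ₁ < ⋯ < μₙ` are the
conjugates of `x`. -/
def IsLeftInterlacingSet (x : ℝ) (K : Finset ℕ) : Prop :=
  ∃ (μ : Fin (minpoly ℚ x).natDegree → ℝ) (k : Fin (minpoly ℚ x).natDegree → ℕ),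
    IsIncreasingListOfConjugates x μ ∧ StrictMono k ∧ Set.range k = (K : Set ℕ) ∧
    (∀ i, (k i : ℝ) < μ i) ∧
    (∀ i j : Fin (minpoly ℚ x).natDegree, (i : ℕ) + 1 = (j : ℕ) → μ i < (k j : ℝ))

/-- `K = {k₁ < ⋯ < kₙ}` with `μ₁ < k₁ < μ₂ < k₂ < ⋯ < μₙ < kₙ`, where `μ₁ < ⋯ < μₙ` are the
conjugates of `x`. -/
def IsRightInterlacingSet (x : ℝ) (K : Finset ℕ) : Prop :=
  ∃ (μ : Fin (minpoly ℚ x).natDegree → ℝ) (k : Fin (minpoly ℚ x).natDegree → ℕ),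
    IsIncreasingListOfConjugates x μ ∧ StrictMono k ∧ Set.range k = (K : Set ℕ) ∧
    (∀ i, μ i < (k i : ℝ)) ∧
    (∀ i j : Fin (minpoly ℚ x).natDegree, (i : ℕ) + 1 = (j : ℕ) → (k i : ℝ) < μ j)

/-- An interlacing set is a left-interlacing or a right-interlacing set. -/
def IsInterlacingSet (x : ℝ) (K : Finset ℕ) : Prop :=
  IsLeftInterlacingSet x K ∨ IsRightInterlacingSet x K

open Polynomial

/-! Put `x = λ²`, with cubic minimal polynomial `F`. In a tree of height at most two, let `k_c` be
the number of leaves below the child `c` of the root. Eliminating leaf and child coordinates from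
the eigenvector equations leaves `∑ 1 / (x - k_c) = 1`. Conversely, such a sum is realised by a tree
(`hasArborealHeight_two_iff`). The question becomes whether `1` is a sum of poles `1 / (x - k)`,
repetitions allowed.

Necessity: with `P = ∏ (X - k)` the equation says `P(x) = P'(x)`, so `F ∣ P - P'` and every
conjugate satisfies it too. The sum of poles is decreasing between poles, and negative to the left
of all of them, which yields left-interlacing. Modulo 2, `P' / P = a / X + b / (X + 1)`, so an
irreducible cubic cannot divide `P - P'` (`exists_isRoot_zmod_two_of_dvd`).

Sufficiency: interlacing gives four naturals at which `F` has signs `-, +, -, +`. A Lagrange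
relation then has positive coefficients, so the poles generate a group
(`neg_inv_mem_poleSums_of_interlacing`). In that group, half a second difference of `F(k) / (x - k)`
equals `-1`, and it has integral coefficients as soon as `F(k)` is even (`one_mem_poleSums`). -/

/-! ### Sums of poles as an additive monoid. -/

/-- The additive monoid of all finite sums of numbers `1 / (x - k)` with `k` a natural number. -/
noncomputable def poleSums (x : ℝ) : AddSubmonoid ℝ :=
  AddSubmonoid.closure (Set.range fun k : ℕ => (x - k)⁻¹)

theorem mem_poleSums_iff {x y : ℝ} :
    y ∈ poleSums x ↔ ∃ s : Multiset ℕ, (s.map fun k : ℕ => (x - k)⁻¹).sum = y := by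
  constructor
  · intro h
    induction h using AddSubmonoid.closure_induction with
    | mem y hy => obtain ⟨k, rfl⟩ := hy; exact ⟨{k}, by simp⟩
    | zero => exact ⟨0, by simp⟩
    | add a b _ _ ha hb =>
      obtain ⟨s, rfl⟩ := ha
      obtain ⟨t, rfl⟩ := hb
      exact ⟨s + t, by simp⟩
  · rintro ⟨s, rfl⟩
    refine AddSubmonoid.multiset_sum_mem _ _ fun y hy => ?_
    obtain ⟨k, -, rfl⟩ := Multiset.mem_map.1 hy
    exact AddSubmonoid.subset_closure ⟨k, rfl⟩

theorem inv_mem_poleSums (x : ℝ) (k : ℕ) : (x - k)⁻¹ ∈ poleSums x :=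
  AddSubmonoid.subset_closure ⟨k, rfl⟩

/-- Here `-v = (n - 1) • v + w`: a vanishing combination with positive coefficients makes each of
its terms invertible in the monoid. -/
theorem AddSubmonoid.neg_mem_of_nsmul_add_mem {M : Type*} [AddCommGroup M] (S : AddSubmonoid M)
    {v w : M} {n : ℕ} (hv : v ∈ S) (hw : w ∈ S) (hn : n ≠ 0) (h : n • v + w = 0) : -v ∈ S := by
  obtain ⟨m, rfl⟩ := Nat.exists_eq_succ_of_ne_zero hn
  have : -v = m • v + w := by
    rw [neg_eq_iff_add_eq_zero, ← h, succ_nsmul]; abel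
  rw [this]
  exact S.add_mem (S.nsmul_mem hv m) hw

theorem AddSubmonoid.zsmul_mem_of_neg_mem {M : Type*} [AddCommGroup M] (S : AddSubmonoid M)
    {v : M} (hv : v ∈ S) (hv' : -v ∈ S) (n : ℤ) : n • v ∈ S := by
  obtain ⟨m, rfl | rfl⟩ := n.eq_nat_or_neg
  · simpa using S.nsmul_mem hv m
  · have := S.nsmul_mem hv' m
    simpa using this

theorem AddSubmonoid.intCast_mul_mem (S : AddSubmonoid ℝ)
    {v : ℝ} (hv : v ∈ S) (hv' : -v ∈ S) (n : ℤ) : (n : ℝ) * v ∈ S := by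
  simpa using S.zsmul_mem_of_neg_mem hv hv' n

theorem AddSubmonoid.intCast_mul_mem_of_nonneg (S : AddSubmonoid ℝ)
    {v : ℝ} (hv : v ∈ S) {n : ℤ} (hn : 0 ≤ n) : (n : ℝ) * v ∈ S := by
  lift n to ℕ using hn
  simpa using S.nsmul_mem hv n

theorem AddSubmonoid.neg_mem_of_intCast_mul_add_eq_zero (S : AddSubmonoid ℝ)
    {v w : ℝ} {n : ℤ} (hv : v ∈ S) (hw : w ∈ S) (hn : 0 < n) (h : n * v + w = 0) : -v ∈ S := by
  lift n to ℕ using hn.le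
  exact S.neg_mem_of_nsmul_add_mem hv hw (n := n) (by omega) (by simpa using h)

/-! ### Integer relations between the poles at a root of a cubic. -/

section Cubic

variable {x : ℝ} {A B C : ℤ}

theorem cubic_mul_inv (hx : x ^ 3 + A * x ^ 2 + B * x + C = 0) {k : ℝ} (hk : x ≠ k) :
    (k ^ 3 + A * k ^ 2 + B * k + C) * (x - k)⁻¹ =
      -(x ^ 2 + (k + A) * x + (k ^ 2 + A * k + B)) := by
  have : x - k ≠ 0 := sub_ne_zero.2 hk
  rw [← div_eq_mul_inv, div_eq_iff this]
  linear_combination hx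

/-- The relation between four poles given by Lagrange interpolation of a cubic vanishing at `x`. -/
theorem cubic_four_pole_relation (hx : x ^ 3 + A * x ^ 2 + B * x + C = 0) {a b c d : ℤ}
    (ha : x ≠ a) (hb : x ≠ b) (hc : x ≠ c) (hd : x ≠ d) :
    ((-(a ^ 3 + A * a ^ 2 + B * a + C) * ((c - b) * (d - b) * (d - c)) : ℤ) : ℝ) * (x - a)⁻¹ +
    (((b ^ 3 + A * b ^ 2 + B * b + C) * ((c - a) * (d - a) * (d - c)) : ℤ) : ℝ) * (x - b)⁻¹ +
    ((-(c ^ 3 + A * c ^ 2 + B * c + C) * ((b - a) * (d - a) * (d - b)) : ℤ) : ℝ) * (x - c)⁻¹ +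
    (((d ^ 3 + A * d ^ 2 + B * d + C) * ((b - a) * (c - a) * (c - b)) : ℤ) : ℝ) * (x - d)⁻¹
      = 0 := by
  push_cast
  -- By `cubic_mul_inv`, `F(k) / (x - k)` is a quadratic polynomial in `k`. The weights are those of
  -- a third divided difference with denominators cleared, which kills quadratics.
  linear_combination
    (-((c - b) * (d - b) * (d - c)) : ℝ) * cubic_mul_inv hx ha +
    ((c - a) * (d - a) * (d - c) : ℝ) * cubic_mul_inv hx hb -
    ((b - a) * (d - a) * (d - b) : ℝ) * cubic_mul_inv hx hc +
    ((b - a) * (c - a) * (c - b) : ℝ) * cubic_mul_inv hx hd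

theorem neg_inv_mem_poleSums_of_interlacing (hx : x ^ 3 + A * x ^ 2 + B * x + C = 0)
    (hF : ∀ k : ℕ, (k : ℤ) ^ 3 + A * k ^ 2 + B * k + C ≠ 0) (hne : ∀ k : ℕ, x ≠ k)
    {a b c d : ℕ} (hab : a < b) (hbc : b < c) (hcd : c < d)
    (ha : (a : ℤ) ^ 3 + A * a ^ 2 + B * a + C < 0) (hb : 0 < (b : ℤ) ^ 3 + A * b ^ 2 + B * b + C)
    (hc : (c : ℤ) ^ 3 + A * c ^ 2 + B * c + C < 0) (hd : 0 < (d : ℤ) ^ 3 + A * d ^ 2 + B * d + C)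
    (j : ℕ) : -(x - j)⁻¹ ∈ poleSums x := by
  have hab' : (0 : ℤ) < b - a := by omega
  have hac' : (0 : ℤ) < c - a := by omega
  have had' : (0 : ℤ) < d - a := by omega
  have hbc' : (0 : ℤ) < c - b := by omega
  have hbd' : (0 : ℤ) < d - b := by omega
  have hcd' : (0 : ℤ) < d - c := by omega
  have key := cubic_four_pole_relation hx (a := a) (b := b) (c := c) (d := d)
    (by exact_mod_cast hne a) (by exact_mod_cast hne b) (by exact_mod_cast hne c)
    (by exact_mod_cast hne d)
  have pa := mul_pos (neg_pos.2 ha) (mul_pos (mul_pos hbc' hbd') hcd')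
  have pb := mul_pos hb (mul_pos (mul_pos hac' had') hcd')
  have pc := mul_pos (neg_pos.2 hc) (mul_pos (mul_pos hab' had') hbd')
  have pd := mul_pos hd (mul_pos (mul_pos hab' hac') hbc')
  simp only [Int.cast_natCast] at key
  have ma := inv_mem_poleSums x a
  have mb := inv_mem_poleSums x b
  have mc := inv_mem_poleSums x c
  have md := inv_mem_poleSums x d
  have qa := (poleSums x).intCast_mul_mem_of_nonneg ma pa.le
  have qb := (poleSums x).intCast_mul_mem_of_nonneg mb pb.le
  have qc := (poleSums x).intCast_mul_mem_of_nonneg mc pc.le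
  have qd := (poleSums x).intCast_mul_mem_of_nonneg md pd.le
  have na : -(x - a)⁻¹ ∈ poleSums x :=
    (poleSums x).neg_mem_of_intCast_mul_add_eq_zero ma (add_mem (add_mem qb qc) qd) pa
      (by linear_combination key)
  have nb : -(x - b)⁻¹ ∈ poleSums x :=
    (poleSums x).neg_mem_of_intCast_mul_add_eq_zero mb (add_mem (add_mem qa qc) qd) pb
      (by linear_combination key)
  have nc : -(x - c)⁻¹ ∈ poleSums x :=
    (poleSums x).neg_mem_of_intCast_mul_add_eq_zero mc (add_mem (add_mem qa qb) qd) pc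
      (by linear_combination key)
  -- The poles at `a`, `b`, `c` are now invertible, so only a nonzero coefficient at `j` is needed.
  -- The position of `j` does not matter, and it may even coincide with one of them.
  have rel := cubic_four_pole_relation hx (a := a) (b := b) (c := c) (d := j)
    (by exact_mod_cast hne a) (by exact_mod_cast hne b) (by exact_mod_cast hne c)
    (by exact_mod_cast hne j)
  simp only [Int.cast_natCast] at rel
  have mj := inv_mem_poleSums x j
  have hs := mul_ne_zero (hF j) (mul_pos (mul_pos hab' hac') hbc').ne'
  have hw (p q r : ℤ) : p * (x - a)⁻¹ + q * (x - b)⁻¹ + r * (x - c)⁻¹ ∈ poleSums x :=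
    add_mem (add_mem ((poleSums x).intCast_mul_mem ma na p) ((poleSums x).intCast_mul_mem mb nb q))
      ((poleSums x).intCast_mul_mem mc nc r)
  obtain ⟨p, q, r, s, hs, rel⟩ : ∃ p q r s : ℤ, s ≠ 0 ∧
      p * (x - a)⁻¹ + q * (x - b)⁻¹ + r * (x - c)⁻¹ + s * (x - j)⁻¹ = 0 := ⟨_, _, _, _, hs, rel⟩
  rcases lt_or_gt_of_ne hs with h | h
  · exact (poleSums x).neg_mem_of_intCast_mul_add_eq_zero mj (hw (-p) (-q) (-r)) (neg_pos.2 h)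
      (by push_cast; linear_combination -rel)
  · exact (poleSums x).neg_mem_of_intCast_mul_add_eq_zero mj (hw p q r) h
      (by linear_combination rel)

/-- If the poles generate a group and the cubic has an even value, `1` is a sum of poles. -/
theorem one_mem_poleSums (hx : x ^ 3 + A * x ^ 2 + B * x + C = 0) (hne : ∀ k : ℕ, x ≠ k)
    (hneg : ∀ j : ℕ, -(x - j)⁻¹ ∈ poleSums x) {k : ℕ}
    (hk : Even ((k : ℤ) ^ 3 + A * k ^ 2 + B * k + C)) : 1 ∈ poleSums x := by
  obtain ⟨m, hm⟩ := hk
  have hm' : (k : ℝ) ^ 3 + A * k ^ 2 + B * k + C = m + m := by exact_mod_cast hm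
  have hmem (n : ℤ) (j : ℕ) : (n : ℝ) * (x - j)⁻¹ ∈ poleSums x :=
    (poleSums x).intCast_mul_mem (inv_mem_poleSums x j) (hneg j) n
  have h0 := cubic_mul_inv hx (hne k)
  have h1 := cubic_mul_inv hx (hne (k + 1))
  have h2 := cubic_mul_inv hx (hne (k + 2))
  push_cast at h1 h2
  -- Minus half the second difference of `F(k) / (x - k)`, whose `k`-dependence is `-k² + …`. The
  -- coefficients are `-F(k+2)/2`, `F(k+1)` and `-F(k)/2`; the first is integral because `F(k+2) -
  -- F(k)` is even.
  have key : (1 : ℝ) =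
      (((-(m + (3 * k ^ 2 + 6 * k + 4 + A * (2 * k + 2) + B)) : ℤ) : ℝ) * (x - (k + 2 : ℕ))⁻¹ +
      ((-m : ℤ) : ℝ) * (x - k)⁻¹) +
      (((k + 1) ^ 3 + A * (k + 1) ^ 2 + B * (k + 1) + C : ℤ) : ℝ) * (x - (k + 1 : ℕ))⁻¹ := by
    push_cast
    linear_combination (1 / 2 : ℝ) * h2 - h1 + (1 / 2 : ℝ) * h0 -
      ((x - (k + 2))⁻¹ / 2 + (x - k)⁻¹ / 2) * hm'
  rw [key]
  exact add_mem (add_mem (hmem _ _) (hmem _ _)) (hmem _ _)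

end Cubic

/-! ### Logarithmic derivatives and the obstruction modulo 2. -/

/-- The monic polynomial with the given multiset of natural numbers as roots. -/
noncomputable def polePoly (R : Type*) [CommRing R] (s : Multiset ℕ) : R[X] :=
  (s.map fun k : ℕ => X - C (k : R)).prod

section polePoly

variable {R : Type*} [CommRing R]

@[simp]
theorem polePoly_zero : polePoly R 0 = 1 := by simp [polePoly]

@[simp]
theorem polePoly_cons (k : ℕ) (s : Multiset ℕ) :
    polePoly R (k ::ₘ s) = (X - C (k : R)) * polePoly R s := by simp [polePoly]

theorem polePoly_map {S : Type*} [CommRing S] (f : R →+* S) (s : Multiset ℕ) :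
    (polePoly R s).map f = polePoly S s := by
  induction s using Multiset.induction_on with
  | empty => simp
  | cons k s ih => simp [ih]

theorem eval_polePoly_ne_zero {K : Type*} [Field K] {x : K} (hx : ∀ k : ℕ, x ≠ k)
    (s : Multiset ℕ) : (polePoly K s).eval x ≠ 0 := by
  induction s using Multiset.induction_on with
  | empty => simp
  | cons k s ih => simpa [sub_eq_zero, ih] using hx k

theorem eval_derivative_polePoly {K : Type*} [Field K] {x : K} (hx : ∀ k : ℕ, x ≠ k)
    (s : Multiset ℕ) : (derivative (polePoly K s)).eval x =
      (polePoly K s).eval x * (s.map fun k : ℕ => (x - k)⁻¹).sum := by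
  induction s using Multiset.induction_on with
  | empty => simp
  | cons k s ih =>
    have : x - k ≠ 0 := sub_ne_zero.2 (hx k)
    simp only [polePoly_cons, derivative_mul, derivative_sub, derivative_X, derivative_C, sub_zero,
      one_mul, eval_add, eval_mul, eval_sub, eval_X, eval_C, ih, Multiset.map_cons,
      Multiset.sum_cons]
    field_simp

theorem aeval_polePoly_sub_derivative_eq_zero_iff {x : ℝ} (hx : ∀ k : ℕ, x ≠ k) (s : Multiset ℕ) :
    aeval x (polePoly ℤ s - derivative (polePoly ℤ s)) = 0 ↔
      (s.map fun k : ℕ => (x - k)⁻¹).sum = 1 := by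
  rw [aeval_def, ← eval_map, Polynomial.map_sub, ← derivative_map, polePoly_map, eval_sub,
    eval_derivative_polePoly hx, sub_eq_zero]
  have := eval_polePoly_ne_zero hx s
  constructor
  · intro h
    exact mul_left_cancel₀ this (by rw [← h, mul_one])
  · intro h
    rw [h, mul_one]

/-- Modulo 2 every linear factor is `X` or `X + 1`, so the logarithmic derivative has at most these
two simple poles. -/
theorem exists_derivative_polePoly_zmod_two (s : Multiset ℕ) : ∃ a b : ZMod 2,
    X * (X + 1) * derivative (polePoly (ZMod 2) s) =
      polePoly (ZMod 2) s * (C a * (X + 1) + C b * X) := by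
  induction s using Multiset.induction_on with
  | empty => exact ⟨0, 0, by simp⟩
  | cons k s ih =>
    obtain ⟨a, b, h⟩ := ih
    have two : (2 : (ZMod 2)[X]) = 0 := by
      rw [← C_ofNat, show (OfNat.ofNat 2 : ZMod 2) = 0 from rfl, C_0]
    have hk : (k : ZMod 2) = 0 ∨ (k : ZMod 2) = 1 := by
      generalize (k : ZMod 2) = z; revert z; decide
    rcases hk with hk | hk
    · refine ⟨a + 1, b, ?_⟩
      simp only [polePoly_cons, hk, derivative_mul, derivative_sub, derivative_X, derivative_zero, C_add,
        C_0, C_1]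
      linear_combination X * h
    · refine ⟨a, b + 1, ?_⟩
      simp only [polePoly_cons, hk, derivative_mul, derivative_sub, derivative_X, derivative_one, C_add,
        C_1]
      linear_combination (X - 1) * h + X * polePoly (ZMod 2) s * two

end polePoly

theorem not_dvd_polePoly_of_irreducible {K : Type*} [Field K] {p : K[X]} (hp : Irreducible p)
    (hdeg : p.natDegree = 3) (s : Multiset ℕ) : ¬ p ∣ polePoly K s := by
  induction s using Multiset.induction_on with
  | empty => simpa using fun h => hp.not_isUnit (isUnit_of_dvd_one h)
  | cons k s ih =>
    rw [polePoly_cons]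
    intro h
    rcases hp.prime.dvd_or_dvd h with h | h
    · have := natDegree_le_of_dvd h (X_sub_C_ne_zero _)
      rw [natDegree_X_sub_C] at this
      omega
    · exact ih h

theorem exists_isRoot_zmod_two_of_dvd {p : ℤ[X]} (hp : p.Monic) (hdeg : p.natDegree = 3)
    {s : Multiset ℕ} (h : p ∣ polePoly ℤ s - derivative (polePoly ℤ s)) :
    ∃ a : ZMod 2, (p.map (Int.castRingHom (ZMod 2))).IsRoot a := by
  by_contra! hroot
  set q := p.map (Int.castRingHom (ZMod 2)) with hq
  have hqm : q.Monic := hp.map _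
  have hqd : q.natDegree = 3 := by rw [hq, hp.natDegree_map, hdeg]
  have hirr : Irreducible q := by
    rw [irreducible_iff_roots_eq_zero_of_degree_le_three (by omega) (by omega)]
    exact Multiset.eq_zero_of_forall_notMem fun a ha => hroot a (isRoot_of_mem_roots ha)
  have hdvd : q ∣ polePoly (ZMod 2) s - derivative (polePoly (ZMod 2) s) := by
    have := Polynomial.map_dvd (Int.castRingHom (ZMod 2)) h
    rwa [Polynomial.map_sub, ← derivative_map, polePoly_map] at this
  obtain ⟨a, b, hab⟩ := exists_derivative_polePoly_zmod_two s
  -- Multiplication by `X (X + 1)` turns `P - P'` into `P` times a monic quadratic; an irreducible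
  -- cubic divides neither factor.
  have hdvd' : q ∣ polePoly (ZMod 2) s * (X * (X + 1) - (C a * (X + 1) + C b * X)) := by
    refine (hdvd.mul_left (X * (X + 1))).trans (dvd_of_eq ?_)
    linear_combination -hab
  rcases hirr.prime.dvd_or_dvd hdvd' with h' | h'
  · exact not_dvd_polePoly_of_irreducible hirr hqd s h'
  · have hquad : X * (X + 1) - (C a * (X + 1) + C b * X) =
        C 1 * X ^ 2 + C (1 - a - b) * X + C (-a) := by
      simp only [C_sub, C_neg, C_1]; ring
    rw [hquad] at h'
    have hd := natDegree_quadratic (b := 1 - a - b) (c := -a) (one_ne_zero (α := ZMod 2))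
    have := natDegree_le_of_dvd h' (by intro h0; rw [h0] at hd; simp at hd)
    omega

/-! ### Location of the solutions of the pole equation. -/

/-- Two points where a sum of poles takes the same value are separated by a pole. -/
theorem exists_pole_between {s : Multiset ℕ} {y z : ℝ} (hyz : y < z)
    (hy : ∀ k : ℕ, y ≠ k) (hz : ∀ k : ℕ, z ≠ k)
    (hsy : (s.map fun k : ℕ => (y - k)⁻¹).sum = 1) (hsz : (s.map fun k : ℕ => (z - k)⁻¹).sum = 1) :
    ∃ k : ℕ, y < k ∧ k < z := by
  by_contra! h
  -- Without a natural number between `y` and `z`, each term is strictly decreasing from `y` to `z`.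
  have hlt : (s.map fun k : ℕ => (z - k)⁻¹).sum < (s.map fun k : ℕ => (y - k)⁻¹).sum := by
    refine Multiset.sum_lt_sum_of_nonempty ?_ fun k _ => ?_
    · rintro rfl; simp at hsy
    · rcases lt_or_gt_of_ne (hy k) with hk | hk
      · have hzk := (h k hk).lt_of_ne (hz k)
        exact (inv_lt_inv_of_neg (by linarith) (by linarith)).2 (by linarith)
      · exact inv_strictAnti₀ (by linarith) (by linarith)
  linarith

theorem exists_pole_lt {s : Multiset ℕ} {y : ℝ}
    (hsy : (s.map fun k : ℕ => (y - k)⁻¹).sum = 1) : ∃ k : ℕ, (k : ℝ) < y := by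
  by_contra! h
  have : (s.map fun k : ℕ => (y - k)⁻¹).sum ≤ (s.map fun _ : ℕ => (0 : ℝ)).sum :=
    Multiset.sum_map_le_sum_map _ _ fun k _ => inv_nonpos.2 (sub_nonpos.2 (h k))
  simp at this
  linarith

/-! ### From a tree of height at most two to a sum of poles. -/

section TreeToSum

variable {V : Type} {T : SimpleGraph V} {r : V}

theorem SimpleGraph.IsTree.length_eq_dist_of_isPath (hT : T.IsTree) {u v : V} {p : T.Walk u v}
    (hp : p.IsPath) : p.length = T.dist u v := by
  obtain ⟨q, hq⟩ := hT.connected.exists_walk_length_eq_dist u v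
  rw [(hT.existsUnique_path u v).unique hp (q.isPath_of_length_eq_dist hq), hq]

theorem SimpleGraph.dist_le_of_eccent_le (hT : T.Connected) {n : ℕ} (h : T.eccent r ≤ n) (v : V) :
    T.dist r v ≤ n := by
  have := (SimpleGraph.edist_le_eccent (G := T) (u := r) (v := v)).trans h
  rw [← (hT r v).coe_dist_eq_edist] at this
  exact_mod_cast this

theorem SimpleGraph.eq_or_adj_or_adj_adj_of_dist_le_two (hT : T.Connected) {v : V}
    (h : T.dist r v ≤ 2) : v = r ∨ T.Adj r v ∨ ∃ c, T.Adj r c ∧ T.Adj c v := by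
  obtain ⟨p, hp⟩ := hT.exists_walk_length_eq_dist r v
  rw [← hp] at h
  match p, h with
  | .nil, _ => exact .inl rfl
  | .cons h .nil, _ => exact .inr (.inl h)
  | .cons h (.cons h' .nil), _ => exact .inr (.inr ⟨_, h, h'⟩)

theorem SimpleGraph.IsTree.dist_eq_two (hT : T.IsTree) {c l : V}
    (hc : T.Adj r c) (hl : T.Adj c l) (hlr : l ≠ r) : T.dist r l = 2 := by
  rw [← hT.length_eq_dist_of_isPath (p := .cons hc (.cons hl .nil))]
  · rfl
  · simp [hc.ne, hl.ne, hlr.symm]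

theorem SimpleGraph.IsTree.eq_of_adj_leaf (hT : T.IsTree) (h2 : ∀ v, T.dist r v ≤ 2) {c l w : V}
    (hc : T.Adj r c) (hl : T.Adj c l) (hlr : l ≠ r) (hw : T.Adj l w) : w = c := by
  by_contra hwc
  have hl2 := hT.dist_eq_two hc hl hlr
  have hwr : w ≠ r := by
    rintro rfl
    rw [SimpleGraph.dist_eq_one_iff_adj.2 hw.symm] at hl2
    omega
  have := hT.length_eq_dist_of_isPath (p := .cons hc (.cons hl (.cons hw .nil)))
    (by simp [hc.ne, hl.ne, hw.ne, hlr.symm, hwr.symm, Ne.symm hwc])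
  have h3 := h2 w
  rw [← this] at h3
  simp at h3

open Classical in
theorem IsGraphEigenvalue.exists_vector [Fintype V] {x : ℝ} (h : IsGraphEigenvalue T x) :
    ∃ u : V → ℝ, u ≠ 0 ∧ ∀ v, ∑ w ∈ T.neighborFinset v, u w = x * u v := by
  obtain ⟨u, hu⟩ := Module.End.HasEigenvalue.exists_hasEigenvector h
  refine ⟨u, hu.2, fun v => ?_⟩
  have := congrFun hu.apply_eq_smul v
  rw [Matrix.toLin'_apply, SimpleGraph.adjMatrix_mulVec_apply] at this
  rw [Pi.smul_apply, smul_eq_mul] at this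
  convert this using 2

open Classical in
/-- The eigenvalue equation of a rooted tree of height at most two, away from the poles. -/
theorem sum_inv_eq_one_of_isGraphEigenvalue [Fintype V] (hT : T.IsTree)
    (h2 : ∀ v, T.dist r v ≤ 2) {x : ℝ} (hx : ∀ k : ℕ, x ^ 2 ≠ k) (h : IsGraphEigenvalue T x) :
    ∑ c ∈ T.neighborFinset r, (x ^ 2 - (((T.neighborFinset c).erase r).card : ℕ))⁻¹ = 1 := by
  obtain ⟨u, hu0, hu⟩ := h.exists_vector
  have hx0 : x ≠ 0 := by rintro rfl; exact hx 0 (by simp)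
  have hleaf : ∀ c l, T.Adj r c → T.Adj c l → l ≠ r → u c = x * u l := by
    intro c l hc hl hlr
    have hN : T.neighborFinset l = {c} := by
      ext w
      simp only [SimpleGraph.mem_neighborFinset, Finset.mem_singleton]
      exact ⟨hT.eq_of_adj_leaf h2 hc hl hlr, fun hw => hw ▸ hl.symm⟩
    rw [← hu l, hN, Finset.sum_singleton]
  -- With `k` leaves below `c`, the equation at `c` reads `x * u c = u r + k * u c / x`.
  have hchild : ∀ c, T.Adj r c →
      u c = x * u r * (x ^ 2 - (((T.neighborFinset c).erase r).card : ℕ))⁻¹ := by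
    intro c hc
    have hr : r ∈ T.neighborFinset c := by simpa using hc.symm
    have hsum : ∑ l ∈ (T.neighborFinset c).erase r, u l =
        ((T.neighborFinset c).erase r).card * (u c / x) := by
      rw [← nsmul_eq_mul]
      refine Finset.sum_eq_card_nsmul fun l hl => ?_
      rw [Finset.mem_erase, SimpleGraph.mem_neighborFinset] at hl
      rw [hleaf c l hc hl.2 hl.1]
      field_simp
    have := hu c
    rw [← Finset.add_sum_erase _ _ hr, hsum] at this
    have hne := sub_ne_zero.2 (hx ((T.neighborFinset c).erase r).card)
    rw [← div_eq_mul_inv, eq_div_iff hne]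
    field_simp at this
    linear_combination -this
  -- A zero at the root would propagate to the children and then to the leaves.
  have hur : u r ≠ 0 := by
    intro h0
    have hc0 : ∀ c, T.Adj r c → u c = 0 := fun c hc => by simp [hchild c hc, h0]
    refine hu0 (funext fun v => ?_)
    rcases SimpleGraph.eq_or_adj_or_adj_adj_of_dist_le_two hT.connected (h2 v) with
      rfl | hv | ⟨c, hc, hv⟩
    · exact h0
    · exact hc0 v hv
    · by_cases hvr : v = r
      · rw [hvr]; exact h0
      · have := hleaf c v hc hv hvr
        rw [hc0 c hc] at this
        simpa [hx0] using this.symm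
  have hroot := hu r
  rw [Finset.sum_congr rfl fun c hc => hchild c ((SimpleGraph.mem_neighborFinset ..).1 hc),
    ← Finset.mul_sum] at hroot
  exact mul_left_cancel₀ (mul_ne_zero hx0 hur) (by rw [hroot, mul_one])

theorem exists_multiset_of_isEigenvalueOfRootedTreeOfHeight_two {x : ℝ}
    (hx : ∀ k : ℕ, x ^ 2 ≠ k) (h : IsEigenvalueOfRootedTreeOfHeight x 2) :
    ∃ s : Multiset ℕ, (s.map fun k : ℕ => (x ^ 2 - k)⁻¹).sum = 1 := by
  classical
  obtain ⟨V, _, T, r, hT, hr, hev⟩ := h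
  have := sum_inv_eq_one_of_isGraphEigenvalue hT
    (SimpleGraph.dist_le_of_eccent_le hT.connected hr.le) hx hev
  refine ⟨(T.neighborFinset r).val.map fun c => ((T.neighborFinset c).erase r).card, ?_⟩
  rw [Multiset.map_map]
  exact this

/-- In height at most one no child has leaves below it, so all poles are at `0` and `x ^ 2` would be
the degree of the root. -/
theorem two_le_of_isEigenvalueOfRootedTreeOfHeight {x : ℝ} (hx : ∀ k : ℕ, x ^ 2 ≠ k) {n : ℕ}
    (h : IsEigenvalueOfRootedTreeOfHeight x n) : 2 ≤ n := by
  classical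
  by_contra! hn
  obtain ⟨V, _, T, r, hT, hr, hev⟩ := h
  have h1 : ∀ v, T.dist r v ≤ n := SimpleGraph.dist_le_of_eccent_le hT.connected hr.le
  have := sum_inv_eq_one_of_isGraphEigenvalue hT (fun v => (h1 v).trans hn.le) hx hev
  have hcard : ∀ c ∈ T.neighborFinset r,
      (x ^ 2 - (((T.neighborFinset c).erase r).card : ℕ))⁻¹ = (x ^ 2)⁻¹ := by
    intro c hc
    rw [SimpleGraph.mem_neighborFinset] at hc
    have : (T.neighborFinset c).erase r = ∅ := by
      refine Finset.eq_empty_of_forall_notMem fun l hl => ?_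
      rw [Finset.mem_erase, SimpleGraph.mem_neighborFinset] at hl
      have := hT.dist_eq_two hc hl.2 hl.1
      have := h1 l
      omega
    simp [this]
  rw [Finset.sum_congr rfl hcard, Finset.sum_const, nsmul_eq_mul, ← div_eq_mul_inv,
    div_eq_one_iff_eq (by simpa using hx 0)] at this
  exact hx _ this.symm

end TreeToSum

/-! ### From a sum of poles to a tree of height two. -/

section SumToTree

/-- The graph joining every point to its image under a self-map. -/
def parentGraph {V : Type} (f : V → V) : SimpleGraph V :=
  SimpleGraph.fromRel fun a b => f a = b

theorem parentGraph_isTree {V : Type} [Fintype V] {f : V → V} {r : V}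
    (h : ∀ v, ∃ n, f^[n] v = r) (hr : f r = r) : (parentGraph f).IsTree := by
  classical
  have hreach (v : V) : (parentGraph f).Reachable v (f v) := by
    by_cases hv : v = f v
    · rw [← hv]
    · exact SimpleGraph.Adj.reachable (by simp [parentGraph, hv])
  have hconn : (parentGraph f).Connected := by
    rw [SimpleGraph.connected_iff_exists_forall_reachable]
    refine ⟨r, fun v => ?_⟩
    obtain ⟨n, hn⟩ := h v
    induction n generalizing v with
    | zero => rw [← hn]; rfl
    | succ n ih => exact (ih (f v) hn).trans (hreach v).symm
  rw [SimpleGraph.isTree_iff_connected_and_card]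
  -- Each edge is `s(v, f v)` for some `v ≠ r`, so there are at most `|V| - 1` edges.
  refine ⟨hconn, le_antisymm ?_ hconn.card_vert_le_card_edgeSet_add_one⟩
  have hsurj : (parentGraph f).edgeFinset ⊆
      (Finset.univ.erase r).image fun v => s(v, f v) := by
    intro e he
    rw [SimpleGraph.mem_edgeFinset] at he
    induction e with
    | _ a b =>
      simp only [Finset.mem_image, Finset.mem_erase, Finset.mem_univ, and_true]
      have hab : a ≠ b ∧ (f a = b ∨ f b = a) := by simpa [parentGraph] using he
      obtain ⟨hab, rfl | rfl⟩ := hab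
      · exact ⟨a, by rintro rfl; exact hab hr.symm, rfl⟩
      · exact ⟨b, by rintro rfl; exact hab hr, Sym2.eq_swap⟩
  have hcard := (Finset.card_le_card hsurj).trans Finset.card_image_le
  rw [Finset.card_erase_of_mem (Finset.mem_univ _), Finset.card_univ,
    SimpleGraph.edgeFinset_card] at hcard
  rw [Nat.card_eq_fintype_card, Nat.card_eq_fintype_card]
  have : 0 < Fintype.card V := Fintype.card_pos_iff.2 ⟨r⟩
  omega

variable {ι : Type} (k : ι → ℕ)

/-- The vertices of a rooted tree of height two whose root has children indexed by `ι`, the child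
`i` having `k i` children. -/
abbrev BroomVertex : Type := Option (Σ i : ι, Option (Fin (k i)))

/-- The parent of a vertex, the root being its own parent. -/
def broomParent : BroomVertex k → BroomVertex k
  | none => none
  | some ⟨_, none⟩ => none
  | some ⟨i, some _⟩ => some ⟨i, none⟩

/-- The coordinates of an eigenvector. -/
noncomputable def broomVector (x : ℝ) : BroomVertex k → ℝ
  | none => 1
  | some ⟨i, none⟩ => x * (x ^ 2 - k i)⁻¹
  | some ⟨i, some _⟩ => (x ^ 2 - k i)⁻¹

theorem broomParent_iterate_two (v : BroomVertex k) : (broomParent k)^[2] v = none := by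
  rcases v with _ | ⟨i, _ | l⟩ <;> rfl

theorem broom_isTree [Fintype ι] : (parentGraph (broomParent k)).IsTree :=
  parentGraph_isTree (fun v => ⟨2, broomParent_iterate_two k v⟩) rfl

theorem broom_eccent_le : (parentGraph (broomParent k)).eccent none ≤ (2 : ℕ) := by
  refine iSup_le fun v => ?_
  have h1 (i : ι) : (parentGraph (broomParent k)).Adj none (some ⟨i, none⟩) := by
    simp [parentGraph, broomParent]
  rcases v with _ | ⟨i, _ | l⟩
  · simp
  · exact (SimpleGraph.edist_le (h1 i).toWalk).trans (by simp)
  · have h2 : (parentGraph (broomParent k)).Adj (some ⟨i, none⟩) (some ⟨i, some l⟩) := by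
      simp [parentGraph, broomParent]
    exact (SimpleGraph.edist_le (.cons (h1 i) h2.toWalk)).trans (by simp)

open Classical in
theorem isGraphEigenvalue_of_vector {V : Type} [Fintype V] {G : SimpleGraph V} {x : ℝ} {u : V → ℝ}
    (hu0 : u ≠ 0) (hu : ∀ v, ∑ w, (if G.Adj v w then u w else 0) = x * u v) :
    IsGraphEigenvalue G x := by
  refine Module.End.hasEigenvalue_of_hasEigenvector (x := u) ⟨?_, hu0⟩
  rw [Module.End.mem_eigenspace_iff, Matrix.toLin'_apply]
  ext v
  rw [SimpleGraph.adjMatrix_mulVec_apply, SimpleGraph.neighborFinset_eq_filter, Finset.sum_filter,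
    hu, Pi.smul_apply, smul_eq_mul]

theorem broom_isGraphEigenvalue [Fintype ι] {x : ℝ} (hx : ∀ n : ℕ, x ^ 2 ≠ n)
    (h : ∑ i, (x ^ 2 - k i)⁻¹ = 1) : IsGraphEigenvalue (parentGraph (broomParent k)) x := by
  classical
  refine isGraphEigenvalue_of_vector (u := broomVector k x) ?_ fun v => ?_
  · intro h0
    simpa [broomVector] using congrFun h0 none
  · rw [Fintype.sum_option, Fintype.sum_sigma]
    simp only [Fintype.sum_option]
    rcases v with _ | ⟨i, _ | l⟩
    · simp [parentGraph, broomParent, broomVector, ← Finset.mul_sum, h]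
    · have hne := sub_ne_zero.2 (hx (k i))
      rw [Finset.sum_eq_single_of_mem i (Finset.mem_univ i)]
      · simp [parentGraph, broomParent, broomVector]
        field_simp
        ring
      · intro j _ hj
        simp [parentGraph, broomParent, hj, hj.symm]
    · rw [Finset.sum_eq_single_of_mem i (Finset.mem_univ i)]
      · simp [parentGraph, broomParent, broomVector]
      · intro j _ hj
        simp [parentGraph, broomParent, hj, hj.symm]

end SumToTree

theorem hasArborealHeight_two_iff {x : ℝ} (hx : ∀ k : ℕ, x ^ 2 ≠ k) :
    HasArborealHeight x 2 ↔ ∃ s : Multiset ℕ, (s.map fun k : ℕ => (x ^ 2 - k)⁻¹).sum = 1 := by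
  classical
  refine ⟨fun h => exists_multiset_of_isEigenvalueOfRootedTreeOfHeight_two hx h.1, ?_⟩
  rintro ⟨s, hs⟩
  refine ⟨?_, fun n hn => two_le_of_isEigenvalueOfRootedTreeOfHeight hx hn⟩
  have hsum : ∑ i : s, (x ^ 2 - ((i : ℕ) : ℝ))⁻¹ = 1 := by
    rw [← hs, Finset.sum, Multiset.map_univ s fun k : ℕ => (x ^ 2 - (k : ℝ))⁻¹]
  have hev := broom_isGraphEigenvalue (fun i : s => (i : ℕ)) hx hsum
  have hle := broom_eccent_le fun i : s => (i : ℕ)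
  -- The height is not computed: it is at most two by construction and at least two because `x` is
  -- an eigenvalue.
  obtain ⟨n, hn⟩ := ENat.ne_top_iff_exists.1 (ne_top_of_le_ne_top (ENat.natCast_ne_top 2) hle)
  have htree : IsEigenvalueOfRootedTreeOfHeight x n :=
    ⟨_, inferInstance, _, none, broom_isTree _, hn.symm, hev⟩
  have h2 := two_le_of_isEigenvalueOfRootedTreeOfHeight hx htree
  rw [← hn] at hle
  rwa [le_antisymm (by exact_mod_cast hle) h2] at htree

/-! ### Conjugates of `λ²` and interlacing sets. -/

/-- Every conjugate of `λ²` is `σ(λ)²` for an embedding `σ` of `ℚ(λ)`, and `σ(λ)` is real. -/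
theorem IsTotallyRealNumber.eq_ofReal_of_aeval_minpoly_sq {lam : ℝ} (h : IsTotallyRealNumber lam)
    {z : ℂ} (hz : aeval z (minpoly ℚ (lam ^ 2)) = 0) : ∃ t : ℝ, 0 ≤ t ∧ z = t := by
  have halg : IsAlgebraic ℚ lam := h.1
  have : Algebra.IsAlgebraic ℚ (IntermediateField.adjoin ℚ {lam}) :=
    IntermediateField.isAlgebraic_adjoin_simple halg.isIntegral
  set g : IntermediateField.adjoin ℚ {lam} := IntermediateField.AdjoinSimple.gen ℚ lam with hg
  have hgl : algebraMap _ ℝ g = lam := IntermediateField.AdjoinSimple.algebraMap_gen ℚ lam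
  have hmin (y : IntermediateField.adjoin ℚ {lam}) :
      minpoly ℚ y = minpoly ℚ (algebraMap (IntermediateField.adjoin ℚ {lam}) ℝ y) :=
    (minpoly.algebraMap_eq (algebraMap (IntermediateField.adjoin ℚ {lam}) ℝ).injective y).symm
  have hint : IsIntegral ℚ (g ^ 2) := Algebra.IsIntegral.isIntegral _
  have hz' : z ∈ (minpoly ℚ (g ^ 2)).rootSet ℂ := by
    rw [mem_rootSet]
    refine ⟨minpoly.ne_zero hint, ?_⟩
    rw [hmin, map_pow, hgl, hz]
  rw [← Algebra.IsAlgebraic.range_eval_eq_rootSet_minpoly] at hz'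
  obtain ⟨σ, hσ⟩ := hz'
  have him : (σ g).im = 0 := by
    refine h.2 _ ?_
    have hg' := hmin g
    rw [hgl] at hg'
    rw [← hg', aeval_algHom_apply, minpoly.aeval, map_zero]
  have hre : σ g = ((σ g).re : ℂ) := Complex.ext rfl (by simpa using him)
  refine ⟨(σ g).re ^ 2, sq_nonneg _, ?_⟩
  rw [← hσ]
  simp only [map_pow]
  rw [hre]
  simp

theorem exists_isIncreasingListOfConjugates {x : ℝ} (hx : IsIntegral ℚ x)
    (h : ∀ z : ℂ, aeval z (minpoly ℚ x) = 0 → ∃ t : ℝ, z = t) :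
    ∃ μ, IsIncreasingListOfConjugates x μ := by
  classical
  have hne := minpoly.ne_zero hx
  have himage : (minpoly ℚ x).rootSet ℂ = Complex.ofReal '' (minpoly ℚ x).rootSet ℝ := by
    have hiff (t : ℝ) : aeval (t : ℂ) (minpoly ℚ x) = 0 ↔ aeval t (minpoly ℚ x) = 0 := by
      have : aeval (t : ℂ) (minpoly ℚ x) = ((aeval t (minpoly ℚ x) : ℝ) : ℂ) :=
        aeval_algebraMap_apply ℂ t _
      rw [this, Complex.ofReal_eq_zero]
    ext z
    simp only [Set.mem_image, mem_rootSet_of_ne hne]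
    constructor
    · intro hz
      obtain ⟨t, rfl⟩ := h z hz
      exact ⟨t, (hiff t).1 hz, rfl⟩
    · rintro ⟨t, ht, rfl⟩
      exact (hiff t).2 ht
  have hcard : ((minpoly ℚ x).rootSet ℝ).toFinset.card = (minpoly ℚ x).natDegree := by
    rw [← card_rootSet_eq_natDegree (K := ℂ) (minpoly.irreducible hx).separable
      (IsAlgClosed.splits _), ← Set.ncard_eq_toFinset_card', ← Nat.card_eq_fintype_card,
      Nat.card_coe_set_eq, himage, Set.ncard_image_of_injective _ Complex.ofReal_injective]
  exact ⟨Finset.orderEmbOfFin _ hcard, (Finset.orderEmbOfFin _ hcard).strictMono, by simp⟩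

theorem ne_natCast_of_aeval_minpoly {x y : ℝ} (hdeg : (minpoly ℚ x).natDegree = 3)
    (hy : aeval y (minpoly ℚ x) = 0) (k : ℕ) : y ≠ k := by
  rintro rfl
  have hx : IsIntegral ℚ x := by
    by_contra h
    rw [minpoly.eq_zero h] at hdeg
    simp at hdeg
  have hroot : (minpoly ℚ x).IsRoot (k : ℚ) := by
    have : aeval (k : ℝ) (minpoly ℚ x) = (((minpoly ℚ x).eval (k : ℚ) : ℚ) : ℝ) := by
      have := aeval_algebraMap_apply ℝ (k : ℚ) (minpoly ℚ x)
      simpa using this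
    rw [this] at hy
    exact_mod_cast hy
  have h1 := natDegree_eq_of_degree_eq_some (n := 1)
    (degree_eq_one_of_irreducible_of_root (minpoly.irreducible hx) hroot)
  omega

theorem exists_isLeftInterlacingSet {x : ℝ} (hx : IsIntegral ℤ x)
    (hdeg : (minpoly ℚ x).natDegree = 3) {μ : Fin (minpoly ℚ x).natDegree → ℝ}
    (hμ : IsIncreasingListOfConjugates x μ) {s : Multiset ℕ}
    (hs : (s.map fun k : ℕ => (x - k)⁻¹).sum = 1) : ∃ K, IsLeftInterlacingSet x K := by
  classical
  have hroot (i) : aeval (μ i) (minpoly ℚ x) = 0 := by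
    have : μ i ∈ (minpoly ℚ x).rootSet ℝ := hμ.2 ▸ Set.mem_range_self i
    exact (mem_rootSet.1 this).2
  have hne (i) := ne_natCast_of_aeval_minpoly hdeg (hroot i)
  have hxne := ne_natCast_of_aeval_minpoly hdeg (minpoly.aeval ℚ x)
  have hsum (i) : (s.map fun k : ℕ => (μ i - k)⁻¹).sum = 1 := by
    rw [← aeval_polePoly_sub_derivative_eq_zero_iff (hne i)]
    have hdvd := minpoly.isIntegrallyClosed_dvd hx
      ((aeval_polePoly_sub_derivative_eq_zero_iff hxne s).2 hs)
    refine aeval_eq_zero_of_dvd_aeval_eq_zero hdvd ?_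
    have := hroot i
    rwa [minpoly.isIntegrallyClosed_eq_field_fractions' ℚ hx, aeval_map_algebraMap] at this
  have hk (j : Fin (minpoly ℚ x).natDegree) : ∃ k : ℕ, (k : ℝ) < μ j ∧
      ∀ i : Fin (minpoly ℚ x).natDegree, (i : ℕ) + 1 = j → μ i < k := by
    rcases Nat.eq_zero_or_pos (j : ℕ) with h0 | h0
    · obtain ⟨k, hk⟩ := exists_pole_lt (hsum j)
      exact ⟨k, hk, fun i hi => by omega⟩
    · let i : Fin (minpoly ℚ x).natDegree := ⟨j - 1, by omega⟩
      have hij : i < j := Fin.lt_def.2 (by simp [i]; omega)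
      obtain ⟨k, hk, hk'⟩ := exists_pole_between (hμ.1 hij) (hne i) (hne j) (hsum i) (hsum j)
      refine ⟨k, hk', fun i' hi' => ?_⟩
      rwa [show i' = i from Fin.ext (by simp [i]; omega)]
  choose k hk hk' using hk
  refine ⟨Finset.univ.image k, μ, k, hμ, ?_, by simp, hk, fun i j => hk' j i⟩
  intro i j hij
  rw [Fin.lt_def] at hij
  let j' : Fin (minpoly ℚ x).natDegree := ⟨j - 1, by omega⟩
  have h1 : μ i ≤ μ j' := hμ.1.monotone (Fin.le_def.2 (by simp [j']; omega))
  have h2 := hk' j j' (by simp [j']; omega)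
  -- `k i < μ i ≤ μ (j - 1) < k j`.
  exact_mod_cast (hk i).trans (h1.trans_lt h2)

/-- Three conjugates together with two natural numbers separating them. -/
theorem IsInterlacingSet.exists_separated {x : ℝ} {K : Finset ℕ} (h : IsInterlacingSet x K)
    (hdeg : (minpoly ℚ x).natDegree = 3) : ∃ (y₁ y₂ y₃ : ℝ) (b c : ℕ),
      aeval y₁ (minpoly ℚ x) = 0 ∧ aeval y₂ (minpoly ℚ x) = 0 ∧ aeval y₃ (minpoly ℚ x) = 0 ∧
      y₁ < b ∧ b < y₂ ∧ y₂ < c ∧ c < y₃ := by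
  have hroot {μ} (hμ : IsIncreasingListOfConjugates x μ) (i) : aeval (μ i) (minpoly ℚ x) = 0 := by
    have : μ i ∈ (minpoly ℚ x).rootSet ℝ := hμ.2 ▸ Set.mem_range_self i
    exact (mem_rootSet.1 this).2
  let i₁ : Fin (minpoly ℚ x).natDegree := ⟨0, by omega⟩
  let i₂ : Fin (minpoly ℚ x).natDegree := ⟨1, by omega⟩
  let i₃ : Fin (minpoly ℚ x).natDegree := ⟨2, by omega⟩
  rcases h with ⟨μ, k, hμ, -, -, h1, h2⟩ | ⟨μ, k, hμ, -, -, h1, h2⟩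
  · exact ⟨μ i₁, μ i₂, μ i₃, k i₂, k i₃, hroot hμ _, hroot hμ _, hroot hμ _, h2 i₁ i₂ rfl, h1 i₂,
      h2 i₂ i₃ rfl, h1 i₃⟩
  · exact ⟨μ i₁, μ i₂, μ i₃, k i₁, k i₂, hroot hμ _, hroot hμ _, hroot hμ _, h1 i₁, h2 i₁ i₂ rfl,
      h1 i₂, h2 i₂ i₃ rfl⟩

/-- Newton interpolation: `e₁₂`, `e₂₃` and `e` are the vanishing divided differences at the roots.
-/
theorem cubic_eq_of_roots {A B C y₁ y₂ y₃ : ℝ} (h₁ : y₁ ^ 3 + A * y₁ ^ 2 + B * y₁ + C = 0)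
    (h₂ : y₂ ^ 3 + A * y₂ ^ 2 + B * y₂ + C = 0) (h₃ : y₃ ^ 3 + A * y₃ ^ 2 + B * y₃ + C = 0)
    (h₁₂ : y₁ < y₂) (h₂₃ : y₂ < y₃) (t : ℝ) :
    t ^ 3 + A * t ^ 2 + B * t + C = (t - y₁) * (t - y₂) * (t - y₃) := by
  have e₁₂ : y₁ ^ 2 + y₁ * y₂ + y₂ ^ 2 + A * (y₁ + y₂) + B = 0 :=
    mul_left_cancel₀ (sub_pos.2 h₁₂).ne' (by linear_combination h₂ - h₁)
  have e₂₃ : y₂ ^ 2 + y₂ * y₃ + y₃ ^ 2 + A * (y₂ + y₃) + B = 0 :=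
    mul_left_cancel₀ (sub_pos.2 h₂₃).ne' (by linear_combination h₃ - h₂)
  have e : y₁ + y₂ + y₃ + A = 0 :=
    mul_left_cancel₀ (sub_pos.2 (h₁₂.trans h₂₃)).ne' (by linear_combination e₂₃ - e₁₂)
  linear_combination h₁ + (t - y₁) * e₁₂ + (t - y₁) * (t - y₂) * e

theorem Polynomial.Monic.eval₂_cubic {S : Type*} [CommRing S] {p : ℤ[X]} (hp : p.Monic)
    (hdeg : p.natDegree = 3) (f : ℤ →+* S) (y : S) :
    p.eval₂ f y = y ^ 3 + f (p.coeff 2) * y ^ 2 + f (p.coeff 1) * y + f (p.coeff 0) := by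
  rw [eval₂_eq_sum_range, hdeg]
  have h3 : p.coeff 3 = 1 := hdeg ▸ hp.coeff_natDegree
  simp [Finset.sum_range_succ, h3]
  ring

theorem one_mem_poleSums_of_interlacing {x : ℝ} (hx : IsIntegral ℤ x)
    (hdeg : (minpoly ℚ x).natDegree = 3)
    (hpos : ∀ y : ℝ, aeval y (minpoly ℚ x) = 0 → 0 < y) {K : Finset ℕ} (hK : IsInterlacingSet x K)
    {a : ZMod 2} (ha : ((minpoly ℤ x).map (Int.castRingHom (ZMod 2))).IsRoot a) :
    1 ∈ poleSums x := by
  obtain ⟨y₁, y₂, y₃, b, c, hy₁, hy₂, hy₃, h₁b, hb₂, h₂c, hc₃⟩ := hK.exists_separated hdeg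
  have hy₁pos := hpos y₁ hy₁
  have hxne := ne_natCast_of_aeval_minpoly hdeg (minpoly.aeval ℚ x)
  have hmin := minpoly.isIntegrallyClosed_eq_field_fractions' ℚ hx
  have hmonic := minpoly.monic hx
  have hdegZ : (minpoly ℤ x).natDegree = 3 := by
    rw [← hdeg, hmin, hmonic.natDegree_map]
  obtain ⟨A, B, C, hABC⟩ : ∃ A B C : ℤ, ∀ {S : Type} [CommRing S] (f : ℤ →+* S) (y : S),
      (minpoly ℤ x).eval₂ f y = y ^ 3 + f A * y ^ 2 + f B * y + f C :=
    ⟨_, _, _, hmonic.eval₂_cubic hdegZ⟩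
  have hroot {y : ℝ} (hy : aeval y (minpoly ℚ x) = 0) :
      y ^ 3 + (A : ℝ) * y ^ 2 + B * y + C = 0 := by
    rw [hmin, aeval_map_algebraMap, aeval_def, hABC] at hy
    simpa using hy
  have hfac := cubic_eq_of_roots (hroot hy₁) (hroot hy₂) (hroot hy₃) (h₁b.trans hb₂)
    (h₂c.trans hc₃)
  have hcast (k : ℕ) : (((k : ℤ) ^ 3 + A * k ^ 2 + B * k + C : ℤ) : ℝ) =
      (k - y₁) * (k - y₂) * (k - y₃) := by
    rw [← hfac]; push_cast; ring
  -- The outer sign changes come for free: `0` lies below the positive conjugates and `d` above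
  -- them, so left- and right-interlacing sets serve equally well.
  obtain ⟨d, hd⟩ := exists_nat_gt y₃
  refine one_mem_poleSums (hroot (minpoly.aeval ℚ x)) hxne (k := a.val)
    (neg_inv_mem_poleSums_of_interlacing (hroot (minpoly.aeval ℚ x)) (fun k h0 => ?_) hxne
      (a := 0) (b := b) (c := c) (d := d) ?_ ?_ ?_ ?_ ?_ ?_ ?_) ?_
  · have := hcast k
    rw [h0, Int.cast_zero, eq_comm, mul_eq_zero, mul_eq_zero, sub_eq_zero, sub_eq_zero,
      sub_eq_zero] at this
    rcases this with (h | h) | h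
    · exact ne_natCast_of_aeval_minpoly hdeg hy₁ k h.symm
    · exact ne_natCast_of_aeval_minpoly hdeg hy₂ k h.symm
    · exact ne_natCast_of_aeval_minpoly hdeg hy₃ k h.symm
  · exact_mod_cast hy₁pos.trans h₁b
  · exact_mod_cast hb₂.trans h₂c
  · exact_mod_cast hc₃.trans hd
  · rw [← Int.cast_lt (R := ℝ), hcast, Int.cast_zero]
    refine mul_neg_of_pos_of_neg (mul_pos_of_neg_of_neg ?_ ?_) ?_ <;> push_cast <;> linarith
  · rw [← Int.cast_lt (R := ℝ), hcast, Int.cast_zero]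
    refine mul_pos_of_neg_of_neg (mul_neg_of_pos_of_neg ?_ ?_) ?_ <;> linarith
  · rw [← Int.cast_lt (R := ℝ), hcast, Int.cast_zero]
    refine mul_neg_of_pos_of_neg (mul_pos ?_ ?_) ?_ <;> linarith
  · rw [← Int.cast_lt (R := ℝ), hcast, Int.cast_zero]
    refine mul_pos (mul_pos ?_ ?_) ?_ <;> linarith
  · rw [IsRoot.def, eval_map, hABC] at ha
    refine even_iff_two_dvd.2 ((ZMod.intCast_zmod_eq_zero_iff_dvd _ 2).1 ?_)
    push_cast
    rw [ZMod.natCast_zmod_val]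
    simpa using ha

theorem mainTheorem1 (lam : ℝ) (hint : IsIntegral ℤ lam) (hreal : IsTotallyRealNumber lam)
    (hdeg : Module.finrank ℚ (IntermediateField.adjoin ℚ {lam ^ 2}) = 3) :
    HasArborealHeight lam 2 ↔
      (∃ K : Finset ℕ, IsInterlacingSet (lam ^ 2) K) ∧
      (∃ a : ZMod 2,
        ((minpoly ℤ (lam ^ 2)).map (Int.castRingHom (ZMod 2))).IsRoot a) := by
  have hx : IsIntegral ℤ (lam ^ 2) := hint.pow 2
  have hxQ : IsIntegral ℚ (lam ^ 2) := hx.tower_top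
  rw [IntermediateField.adjoin.finrank hxQ] at hdeg
  have hxne := ne_natCast_of_aeval_minpoly hdeg (minpoly.aeval ℚ (lam ^ 2))
  rw [hasArborealHeight_two_iff hxne]
  constructor
  · rintro ⟨s, hs⟩
    obtain ⟨μ, hμ⟩ := exists_isIncreasingListOfConjugates hxQ fun z hz =>
      (hreal.eq_ofReal_of_aeval_minpoly_sq hz).imp fun _ h => h.2
    refine ⟨(exists_isLeftInterlacingSet hx hdeg hμ hs).imp fun _ h => .inl h, ?_⟩
    refine exists_isRoot_zmod_two_of_dvd (minpoly.monic hx) ?_ (minpoly.isIntegrallyClosed_dvd hx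
      ((aeval_polePoly_sub_derivative_eq_zero_iff hxne s).2 hs))
    rw [← hdeg, minpoly.isIntegrallyClosed_eq_field_fractions' ℚ hx,
      (minpoly.monic hx).natDegree_map]
  · rintro ⟨⟨K, hK⟩, a, ha⟩
    refine mem_poleSums_iff.1 (one_mem_poleSums_of_interlacing hx hdeg (fun y hy => ?_) hK ha)
    have hyC : aeval (y : ℂ) (minpoly ℚ (lam ^ 2)) = 0 := by
      have := aeval_algebraMap_apply ℂ y (minpoly ℚ (lam ^ 2))
      rw [hy, map_zero] at this
      exact this
    obtain ⟨t, ht, hyt⟩ := hreal.eq_ofReal_of_aeval_minpoly_sq hyC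
    rw [Complex.ofReal_inj] at hyt
    have hy0 := ne_natCast_of_aeval_minpoly hdeg hy 0
    rw [Nat.cast_zero] at hy0
    exact lt_of_le_of_ne (hyt ▸ ht) hy0.symm
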